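/- Let $p$ be a prime, $l\ge 1$, $q=p^l$, and let $k\ge 1$ and $n\ge 2$ be integers. Put $d=\gcd(k,q-1)$. The set of all finite sums of $k$-th powers of elements of $\mathbb F_q$ is a subfield $\mathbb F_{p^{\ell}}$ of $\mathbb F_q$; this defines the divisor $\ell$ of $l$. Let $P=\{A^k+B^k \mid A,B\in M_n(\mathbb F_q)\}$. Suppose that $\ell=l$ and $p\nmid k$. (a) Suppose $q\ge 3d+1$. If $d=2$, or if $d>2$ and $$n>\max\left\{\frac{d-1}{2},\ \frac{4\ln(k-1)}{\ln q}\right\},$$ then $P=M_n(\mathbb F_q)$. (b) Suppose $q=2d+1$. If $d=2$, or if $d>2$ and $$n>\max\left\{2d-1,\ \frac{4\ln(k-1)}{\ln q}\right\},$$ then $P=M_n(\mathbb F_q)$. -/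

import Mathlib

/-- The `s`-fold sumset `sT = {x₁ + ⋯ + xₛ | x₁, …, xₛ ∈ T}`. -/
def sumset {S : Type*} [AddCommMonoid S] (s : ℕ) (T : Set S) : Set S :=
  {x | ∃ f : Fin s → S, (∀ i, f i ∈ T) ∧ ∑ i, f i = x}

/-- The set `{a ^ k | a ∈ R}` of `k`-th powers of `R`; it is used both for the field `F`
and for the ring of `n × n` matrices over `F`. -/
def kPowers (k : ℕ) (R : Type*) [Monoid R] : Set R :=
  {x | ∃ a : R, a ^ k = x}

/-- The set `P` of the `n × n` matrices over `F` that are sums of two `k`-th powers. -/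
def twoPowerSums (k n : ℕ) (F : Type*) [Field F] : Set (Matrix (Fin n) (Fin n) F) :=
  sumset 2 (kPowers k (Matrix (Fin n) (Fin n) F))

/-- `ℓ` is the exponent for which the set of all finite sums of `k`-th powers in the finite field
`F` of characteristic `p` is the subfield of `F` with `p ^ ℓ` elements. -/
def IsPowerSumExponent (p k : ℕ) (F : Type*) [Field F] (ℓ : ℕ) : Prop :=
  ∃ K : Subfield F, Nat.card K = p ^ ℓ ∧ (⋃ s ≥ 1, sumset s (kPowers k F)) = (K : Set F)

/-! Scalar and non-scalar matrices are handled by different means.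

A scalar c is treated in the field with q^n elements, which embeds in the n × n matrices by its
regular representation. A Jacobi sum estimate shows that every element of a finite field with more
than (k-1)^4 elements is a sum of two k-th powers, and the logarithmic hypothesis says exactly
(k-1)^4 < q^n. If d = 2, two squares in F itself suffice.

A non-scalar M is similar to a matrix with any prescribed diagonal of the same trace
(`exists_conj_diag_eq_of_trace_eq`). Split such a conjugate into upper plus lower triangular. A
triangular matrix is a k-th power when its diagonal entries are k-th powers, at most one of them
zero and p ∤ k (`exists_pow_eq_of_isUpperTriangular`). So only the trace matters: it must be a sum
of 2n k-th powers with at most one zero in each half.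

The nonzero k-th powers form the group H of m-th roots of unity, m = (q-1)/d, and H generates F
additively. For m ≥ 3, adding H to a union of H-orbits gains a full orbit of nonzero elements until
F is filled (`MulStable.card_erase_add_le`), so d summands reach every nonzero element. What is left
is zero when d = 2n, where the two allowed zeros are used. For m = 2, growth by one element per
summand is enough. -/

/-! ### Jacobi sums, and scalar matrices as sums of two powers. -/

open Finset in
theorem norm_jacobiSum_le {K : Type*} [Field K] [Fintype K] {χ φ : MulChar K ℂ} (hχ : χ ≠ 1)
    (hφ : φ ≠ 1) : ‖jacobiSum χ φ‖ ≤ √(Fintype.card K) := by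
  by_cases h : χ * φ = 1
  · obtain rfl : φ = χ⁻¹ := eq_inv_of_mul_eq_one_right h
    rw [jacobiSum_nontrivial_inv hχ, norm_neg]
    have h1 : χ (-1) ^ 2 = 1 := by rw [← map_pow, neg_one_sq, map_one]
    have h2 : ‖χ (-1)‖ = 1 := by
      have := congrArg norm h1
      rw [norm_pow, norm_one] at this
      exact (pow_eq_one_iff_of_nonneg (norm_nonneg _) two_ne_zero).mp this
    rw [h2]
    exact Real.one_le_sqrt.mpr (by exact_mod_cast Fintype.card_pos)
  · have hc : ringChar ℂ ≠ ringChar K := by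
      rw [ringChar.eq_zero]
      exact (CharP.ringChar_ne_zero_of_finite K).symm
    have h1 := jacobiSum_mul_jacobiSum_inv hc hχ hφ h
    have h2 : jacobiSum χ⁻¹ φ⁻¹ = (starRingEnd ℂ) (jacobiSum χ φ) := by
      rw [jacobiSum, jacobiSum, map_sum]
      refine sum_congr rfl fun x _ => ?_
      rw [map_mul, ← MulChar.star_apply', ← MulChar.star_apply']
      rfl
    rw [h2, Complex.mul_conj] at h1
    have h3 : Complex.normSq (jacobiSum χ φ) = Fintype.card K := by exact_mod_cast h1
    rw [← h3, Complex.normSq_eq_norm_sq, Real.sqrt_sq (norm_nonneg _)]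

theorem exists_pow_eq_of_mulChar_eq_one {K : Type*} [Field K] [Fintype K] {e : ℕ}
    {χ : MulChar K ℂ} (hχ : orderOf χ = e) {u : K} (hu : χ u = 1) : ∃ a : K, a ^ e = u := by
  have hu0 : u ≠ 0 := fun h => zero_ne_one (by rw [← hu, h, MulChar.map_zero])
  obtain ⟨g, hg⟩ := IsCyclic.exists_generator (α := Kˣ)
  obtain ⟨a, ha⟩ := mem_powers_iff_mem_zpowers.mpr (hg (Units.mk0 u hu0))
  have hau : (g : K) ^ a = u := by
    have := congrArg Units.val ha
    simpa using this
  have h1 : χ ^ a = 1 := by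
    rw [MulChar.eq_iff hg]
    rw [MulChar.pow_apply_coe, ← map_pow, hau, hu, MulChar.one_apply_coe]
  obtain ⟨c, rfl⟩ := hχ ▸ orderOf_dvd_of_pow_eq_one h1
  exact ⟨(g : K) ^ c, by rw [← hau, ← pow_mul, mul_comm]⟩

theorem sum_mulChar_mul_mulChar {K : Type*} [Field K] [Fintype K] (χ φ : MulChar K ℂ) {c : K}
    (hc : c ≠ 0) : ∑ x, χ x * φ (c - x) = (χ * φ) c * jacobiSum χ φ := by
  rw [jacobiSum, Finset.mul_sum, ← Equiv.sum_comp (Equiv.mulLeft₀ c hc)]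
  refine Finset.sum_congr rfl fun x _ => ?_
  rw [Equiv.mulLeft₀_apply, show c - c * x = c * (1 - x) by ring, map_mul, map_mul,
    MulChar.mul_apply]
  ring

/-- A geometric series with ratio `χ u ≠ 1` and `χ u ^ e = 1`; it serves as a detector of e-th
powers. -/
theorem sum_pow_mulChar_eq_zero {K : Type*} [Field K] [Fintype K] {e : ℕ}
    {χ : MulChar K ℂ} (hχ : orderOf χ = e) {u : K}
    (hu : ¬ ∃ a : K, a ^ e = u) : ∑ i ∈ Finset.range e, (χ ^ i) u = 0 := by
  by_cases hu0 : u = 0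
  · subst hu0
    exact Finset.sum_eq_zero fun i _ => MulChar.map_zero _
  have h1 : χ u ≠ 1 := fun h => hu (exists_pow_eq_of_mulChar_eq_one hχ h)
  have h2 : ∀ i, (χ ^ i) u = χ u ^ i := fun i => by
    simpa using MulChar.pow_apply_coe χ i (Units.mk0 u hu0)
  simp_rw [h2]
  refine eq_zero_of_ne_zero_of_mul_right_eq_zero (sub_ne_zero.mpr h1) ?_
  rw [geom_sum_mul, ← h2, ← hχ, pow_orderOf_eq_one, MulChar.one_apply (isUnit_iff_ne_zero.mpr hu0),
    sub_self]

open Finset in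
theorem exists_pow_add_pow_of_dvd {K : Type*} [Field K] [Fintype K] {e : ℕ}
    (he : e ∣ Fintype.card K - 1) (hcard : (e - 1) ^ 4 < Fintype.card K) (c : K) :
    ∃ a b : K, a ^ e + b ^ e = c := by
  have hQ : 0 < Fintype.card K - 1 := Nat.sub_pos_of_lt Fintype.one_lt_card
  have he0 : 0 < e := Nat.pos_of_dvd_of_pos he hQ
  -- Once c is known not to be a power, the character sum at c vanishes, which makes the main term
  -- below exactly the cardinality.
  by_cases hc : ∃ a : K, a ^ e = c
  · obtain ⟨a, ha⟩ := hc
    exact ⟨a, 0, by rw [zero_pow he0.ne', add_zero, ha]⟩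
  have hc0 : c ≠ 0 := by
    rintro rfl
    exact hc ⟨0, zero_pow he0.ne'⟩
  by_contra hne
  obtain ⟨χ, hχ⟩ := MulChar.exists_mulChar_orderOf K he (Complex.isPrimitiveRoot_exp e he0.ne')
  have hne1 : ∀ i ∈ range (e - 1), χ ^ (i + 1) ≠ 1 := fun i hi =>
    pow_ne_one_of_lt_orderOf (Nat.succ_ne_zero i) (by rw [hχ]; have := mem_range.mp hi; omega)
  have hS : ∑ i ∈ range e, (χ ^ i) c = 0 := sum_pow_mulChar_eq_zero hχ hc
  have hzero : ∑ x, (∑ i ∈ range e, (χ ^ i) x) * (∑ j ∈ range e, (χ ^ j) (c - x)) = 0 := by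
    refine sum_eq_zero fun x _ => ?_
    by_cases hx : ∃ a : K, a ^ e = x
    · rw [sum_pow_mulChar_eq_zero hχ (u := c - x), mul_zero]
      rintro ⟨b, hb⟩
      obtain ⟨a, ha⟩ := hx
      exact hne ⟨a, b, by rw [ha, hb]; ring⟩
    · rw [sum_pow_mulChar_eq_zero hχ hx, zero_mul]
  have hexp : ∑ i ∈ range e, ∑ j ∈ range e, (χ ^ (i + j)) c * jacobiSum (χ ^ i) (χ ^ j) = 0 := by
    rw [← hzero]
    simp_rw [sum_mul_sum]
    symm
    rw [sum_comm]
    refine sum_congr rfl fun i _ => ?_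
    rw [sum_comm]
    refine sum_congr rfl fun j _ => ?_
    rw [sum_mulChar_mul_mulChar _ _ hc0, pow_add]
  obtain ⟨r, rfl⟩ : ∃ r, e = r + 1 := ⟨e - 1, by omega⟩
  rw [Nat.add_sub_cancel] at hcard hne1
  have h1c : (1 : MulChar K ℂ) c = 1 := MulChar.one_apply (isUnit_iff_ne_zero.mpr hc0)
  have hS' : ∑ i ∈ range r, (χ ^ (i + 1)) c = -1 := by
    rw [sum_range_succ', pow_zero, h1c] at hS
    exact eq_neg_of_add_eq_zero_left hS
  have hrow : ∑ j ∈ range r, (χ ^ (j + 1)) c * jacobiSum 1 (χ ^ (j + 1)) = 1 := by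
    rw [sum_congr rfl fun j hj => by rw [jacobiSum_one_nontrivial (hne1 j hj)], ← sum_mul, hS']
    norm_num
  -- The pair (0, 0) contributes card K - 2, and each of the two families with one trivial character
  -- contributes 1.
  have hmain : (Fintype.card K : ℂ) =
      -∑ i ∈ range r, ∑ j ∈ range r,
        (χ ^ (i + 1 + (j + 1))) c * jacobiSum (χ ^ (i + 1)) (χ ^ (j + 1)) := by
    have hcol : ∑ i ∈ range r, (χ ^ (i + 1)) c * jacobiSum (χ ^ (i + 1)) 1 = 1 := by
      simpa only [jacobiSum_comm _ (1 : MulChar K ℂ)] using hrow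
    rw [sum_range_succ'] at hexp
    simp only [sum_range_succ' _ r, zero_add, add_zero, pow_zero, sum_add_distrib, hrow, hcol,
      h1c, jacobiSum_one_one] at hexp
    linear_combination hexp
  have hle : (Fintype.card K : ℝ) ≤ r * (r * √(Fintype.card K)) := by
    calc (Fintype.card K : ℝ) = ‖(Fintype.card K : ℂ)‖ := by simp
      _ ≤ ∑ i ∈ range r, ∑ j ∈ range r, √(Fintype.card K) := by
        rw [hmain, norm_neg]
        refine (norm_sum_le _ _).trans (sum_le_sum fun i hi => ?_)
        refine (norm_sum_le _ _).trans (sum_le_sum fun j hj => ?_)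
        rw [norm_mul]
        have hb : ‖(χ ^ (i + 1 + (j + 1))) c‖ ≤ 1 := by
          have h2 : (χ ^ (i + 1 + (j + 1))) c ^ (r + 1) = 1 := by
            have h3 : ∀ l, (χ ^ l) c = χ c ^ l := fun l => by
              simpa using MulChar.pow_apply_coe χ l (Units.mk0 c hc0)
            rw [h3, ← pow_mul, mul_comm, pow_mul, ← h3, ← hχ, pow_orderOf_eq_one, h1c, one_pow]
          exact (Complex.norm_eq_one_of_pow_eq_one h2 (Nat.succ_ne_zero r)).le
        calc _ ≤ 1 * √(Fintype.card K : ℝ) :=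
              mul_le_mul hb (norm_jacobiSum_le (hne1 i hi) (hne1 j hj)) (norm_nonneg _) zero_le_one
          _ = _ := one_mul _
      _ = _ := by simp
  have hpos : 0 < √(Fintype.card K : ℝ) := Real.sqrt_pos.mpr (by exact_mod_cast Fintype.card_pos)
  have hsq : √(Fintype.card K : ℝ) ^ 2 = Fintype.card K := Real.sq_sqrt (Nat.cast_nonneg _)
  have h4 : √(Fintype.card K : ℝ) ≤ (r : ℝ) ^ 2 := by
    refine le_of_mul_le_mul_right ?_ hpos
    linarith
  have h5 : (Fintype.card K : ℝ) ≤ (r : ℝ) ^ 4 := by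
    calc (Fintype.card K : ℝ) = √(Fintype.card K : ℝ) ^ 2 := hsq.symm
      _ ≤ ((r : ℝ) ^ 2) ^ 2 := by gcongr
      _ = _ := by ring
  exact absurd h5 (not_le.mpr (by exact_mod_cast hcard))

theorem exists_pow_eq_pow_gcd {K : Type*} [Field K] [Finite K] (k : ℕ) (hk : k ≠ 0) (a : K) :
    ∃ b : K, b ^ k = a ^ Nat.gcd k (Nat.card K - 1) := by
  by_cases ha : a = 0
  · exact ⟨0, by rw [ha, zero_pow hk, zero_pow (Nat.gcd_ne_zero_left hk)]⟩
  · obtain ⟨u, rfl⟩ : ∃ u : Kˣ, a = u := ⟨Units.mk0 a ha, rfl⟩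
    have h := Nat.gcd_eq_gcd_ab k (Nat.card K - 1)
    have hc : Nat.card Kˣ = Nat.card K - 1 := Nat.card_units K
    refine ⟨((u ^ (Nat.gcdA k (Nat.card K - 1)) : Kˣ) : K), ?_⟩
    rw [← Units.val_pow_eq_pow_val, ← Units.val_pow_eq_pow_val]
    congr 1
    rw [← zpow_natCast u (Nat.gcd _ _), h, zpow_add, zpow_mul _ ((Nat.card K - 1 : ℕ) : ℤ), zpow_natCast, ← hc,
      pow_card_eq_one', one_zpow, mul_one, mul_comm, zpow_mul, zpow_natCast]

theorem exists_pow_add_pow_of_lt_card {K : Type*} [Field K] [Finite K] {k : ℕ} (hk : k ≠ 0)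
    (hcard : (k - 1) ^ 4 < Nat.card K) (c : K) : ∃ a b : K, a ^ k + b ^ k = c := by
  have := Fintype.ofFinite K
  have hle : Nat.gcd k (Nat.card K - 1) ≤ k := Nat.gcd_le_left _ (Nat.pos_of_ne_zero hk)
  obtain ⟨a, b, hab⟩ := exists_pow_add_pow_of_dvd (K := K) (e := Nat.gcd k (Nat.card K - 1))
    (by rw [← Nat.card_eq_fintype_card]; exact Nat.gcd_dvd_right _ _)
    (by
      rw [← Nat.card_eq_fintype_card]
      exact (Nat.pow_le_pow_left (Nat.sub_le_sub_right hle 1) 4).trans_lt hcard) c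
  obtain ⟨a', ha⟩ := exists_pow_eq_pow_gcd k hk a
  obtain ⟨b', hb⟩ := exists_pow_eq_pow_gcd k hk b
  exact ⟨a', b', by rw [ha, hb, hab]⟩

theorem exists_matrix_pow_add_pow_eq_scalar {F : Type*} [Field F] [Finite F] {k n : ℕ}
    (hk : k ≠ 0) (hn : n ≠ 0) (hcard : (k - 1) ^ 4 < Nat.card F ^ n) (c : F) :
    ∃ A B : Matrix (Fin n) (Fin n) F, A ^ k + B ^ k = Matrix.scalar (Fin n) c := by
  obtain ⟨p, hp⟩ := CharP.exists F
  have : Fact p.Prime := ⟨CharP.char_is_prime F p⟩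
  have : NeZero n := ⟨hn⟩
  let K := FiniteField.Extension F p n
  have hfr : Module.finrank F K = n := FiniteField.finrank_extension F p n
  obtain ⟨a, b, hab⟩ := exists_pow_add_pow_of_lt_card (K := K) hk
    (by rwa [FiniteField.natCard_extension]) (algebraMap F K c)
  let φ := Algebra.leftMulMatrix (Module.finBasisOfFinrankEq F K hfr)
  refine ⟨φ a, φ b, ?_⟩
  rw [← map_pow, ← map_pow, ← map_add, hab, AlgHom.commutes]
  rfl

/-! ### Prescribing the diagonal of a non-scalar matrix. -/

section Conjugation

open Matrix Finset

variable {F ι : Type*} [Field F] [Fintype ι] [DecidableEq ι]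

theorem conj_transvection_apply_diag_of_ne {M : Matrix ι ι F} {a b x : ι} (c : F) (hxa : x ≠ a)
    (hxb : x ≠ b) : (transvection a b c * M * transvection a b (-c)) x x = M x x := by
  rw [mul_transvection_apply_of_ne _ _ _ _ hxb, transvection_mul_apply_of_ne _ _ _ _ hxa]

theorem transvection_mul_neg {a b : ι} (hab : a ≠ b) (c : F) :
    transvection a b (-c) * transvection a b c = 1 := by
  rw [transvection_mul_transvection_same _ _ hab, neg_add_cancel, transvection_zero]

/-- The effect of conjugation can be postponed: it suffices to treat a transvection conjugate. -/
theorem exists_conj_of_conj_transvection {M : Matrix ι ι F} {p : Matrix ι ι F → Prop} {a b : ι}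
    (hab : a ≠ b) (c : F)
    (h : ∃ P Q : Matrix ι ι F, Q * P = 1 ∧
      p (P * (transvection a b c * M * transvection a b (-c)) * Q)) :
    ∃ P Q : Matrix ι ι F, Q * P = 1 ∧ p (P * M * Q) := by
  obtain ⟨P, Q, hQP, hp⟩ := h
  refine ⟨P * transvection a b c, transvection a b (-c) * Q, ?_, ?_⟩
  · calc _ = transvection a b (-c) * (Q * P) * transvection a b c := by simp only [mul_assoc]
      _ = 1 := by rw [hQP, mul_one, transvection_mul_neg hab]
  · simpa only [mul_assoc] using hp

/-- Conjugating by 1 + cE_ij adds c · M j i to the (i, i) entry, so a nonzero M j i lets that entry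
be set at will. Induction then drops i from s, provided a nonzero off-diagonal entry survives among
the remaining indices. -/
theorem exists_conj_diag_eq_of_apply_ne_zero (γ : ι → F) (s : Finset ι) :
    ∀ (M : Matrix ι ι F) (i j : ι), i ∈ s → j ∈ s → i ≠ j → M j i ≠ 0 →
      ∃ P Q : Matrix ι ι F, Q * P = 1 ∧
        ((∃ t ∈ s, ∀ x ∈ s, x ≠ t → (P * M * Q) x x = γ x) ∧
          ∀ x ∉ s, (P * M * Q) x x = M x x) := by
  induction s using Finset.strongInduction with
  | H s ih =>
  have ne_of_notMem : ∀ {x y : ι}, x ∉ s → y ∈ s → x ≠ y := fun hx hy h => hx (h ▸ hy)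
  -- with `M i i` already correct
  have step : ∀ (M : Matrix ι ι F) (i j : ι), i ∈ s → j ∈ s → i ≠ j → M j i ≠ 0 → M i i = γ i →
      ∃ P Q : Matrix ι ι F, Q * P = 1 ∧
        ((∃ t ∈ s, ∀ x ∈ s, x ≠ t → (P * M * Q) x x = γ x) ∧
          ∀ x ∉ s, (P * M * Q) x x = M x x) := by
    intro M i j hi hj hij hM hMi
    by_cases hk : ∃ k ∈ s, k ≠ i ∧ k ≠ j
    swap
    · push Not at hk
      refine ⟨1, 1, by simp, ⟨j, hj, fun x hx hxj => ?_⟩, by simp⟩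
      rw [one_mul, mul_one]
      by_cases hxi : x = i
      · rw [hxi, hMi]
      · exact absurd (hk x hx hxi) hxj
    obtain ⟨k, hks, hki, hkj⟩ := hk
    have step' : ∀ M : Matrix ι ι F, M i i = γ i → M j k ≠ 0 →
        ∃ P Q : Matrix ι ι F, Q * P = 1 ∧
          ((∃ t ∈ s, ∀ x ∈ s, x ≠ t → (P * M * Q) x x = γ x) ∧
            ∀ x ∉ s, (P * M * Q) x x = M x x) := by
      intro M hMi hMjk
      obtain ⟨P, Q, hQP, ⟨t, ht, h1⟩, h2⟩ := ih (s.erase i) (erase_ssubset hi) M k j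
        (mem_erase.mpr ⟨hki, hks⟩) (mem_erase.mpr ⟨hij.symm, hj⟩) hkj hMjk
      refine ⟨P, Q, hQP, ⟨t, mem_of_mem_erase ht, fun x hx hxt => ?_⟩, fun x hx => h2 x ?_⟩
      · by_cases hxi : x = i
        · rw [hxi, h2 i (notMem_erase i s), hMi]
        · exact h1 x (mem_erase.mpr ⟨hxi, hx⟩) hxt
      · exact fun h => hx (mem_of_mem_erase h)
    -- If M j k = 0, conjugation by 1 + E_ik turns it into -M j i ≠ 0, and M k i = 0 keeps the (i,
    -- i) entry.
    have step'' : ∀ M : Matrix ι ι F, M i i = γ i → M j i ≠ 0 → M k i = 0 →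
        ∃ P Q : Matrix ι ι F, Q * P = 1 ∧
          ((∃ t ∈ s, ∀ x ∈ s, x ≠ t → (P * M * Q) x x = γ x) ∧
            ∀ x ∉ s, (P * M * Q) x x = M x x) := by
      intro M hMi hMji hMki
      by_cases hMjk : M j k = 0
      swap
      · exact step' M hMi hMjk
      have key := step' (transvection i k 1 * M * transvection i k (-1))
        (by rw [mul_transvection_apply_of_ne _ _ _ _ hki.symm, transvection_mul_apply_same, hMki,
              mul_zero, add_zero, hMi])
        (by rw [mul_transvection_apply_same, transvection_mul_apply_of_ne _ _ _ _ hij.symm,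
              transvection_mul_apply_of_ne _ _ _ _ hij.symm, hMjk, zero_add]
            exact mul_ne_zero (neg_ne_zero.mpr one_ne_zero) hMji)
      refine exists_conj_of_conj_transvection (p := fun N =>
        (∃ t ∈ s, ∀ x ∈ s, x ≠ t → N x x = γ x) ∧ ∀ x ∉ s, N x x = M x x) hki.symm 1 ?_
      obtain ⟨P, Q, hQP, h1, h2⟩ := key
      refine ⟨P, Q, hQP, h1, fun x hx => (h2 x hx).trans ?_⟩
      exact conj_transvection_apply_diag_of_ne 1 (ne_of_notMem hx hi) (ne_of_notMem hx hks)
    -- Adding this multiple of row j to row k clears M k i; the accompanying column operation only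
    -- touches column j.
    refine exists_conj_of_conj_transvection (p := fun N =>
        (∃ t ∈ s, ∀ x ∈ s, x ≠ t → N x x = γ x) ∧ ∀ x ∉ s, N x x = M x x) hkj
        (-(M k i / M j i)) ?_
    obtain ⟨P, Q, hQP, h1, h2⟩ := step'' (transvection k j (-(M k i / M j i)) * M *
        transvection k j (- -(M k i / M j i)))
      (by rw [mul_transvection_apply_of_ne _ _ _ _ hij,
            transvection_mul_apply_of_ne _ _ _ _ hki.symm, hMi])
      (by rwa [mul_transvection_apply_of_ne _ _ _ _ hij,
            transvection_mul_apply_of_ne _ _ _ _ hkj.symm])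
      (by rw [mul_transvection_apply_of_ne _ _ _ _ hij, transvection_mul_apply_same, neg_mul,
            div_mul_cancel₀ _ hM, add_neg_cancel])
    refine ⟨P, Q, hQP, h1, fun x hx => (h2 x hx).trans ?_⟩
    exact conj_transvection_apply_diag_of_ne _ (ne_of_notMem hx hks) (ne_of_notMem hx hj)
  intro M i j hi hj hij hM
  refine exists_conj_of_conj_transvection (p := fun N =>
        (∃ t ∈ s, ∀ x ∈ s, x ≠ t → N x x = γ x) ∧ ∀ x ∉ s, N x x = M x x) hij
        ((γ i - M i i) / M j i) ?_
  obtain ⟨P, Q, hQP, h1, h2⟩ := step (transvection i j ((γ i - M i i) / M j i) * M *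
      transvection i j (-((γ i - M i i) / M j i))) i j hi hj hij
    (by rwa [mul_transvection_apply_of_ne _ _ _ _ hij,
          transvection_mul_apply_of_ne _ _ _ _ hij.symm])
    (by rw [mul_transvection_apply_of_ne _ _ _ _ hij, transvection_mul_apply_same,
          div_mul_cancel₀ _ hM]; ring)
  refine ⟨P, Q, hQP, h1, fun x hx => (h2 x hx).trans ?_⟩
  exact conj_transvection_apply_diag_of_ne _ (ne_of_notMem hx hi) (ne_of_notMem hx hj)

theorem exists_conj_diag_eq_of_trace_eq {M : Matrix ι ι F} (hM : ∀ c, M ≠ scalar ι c) {γ : ι → F}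
    (hγ : ∑ i, γ i = M.trace) :
    ∃ P Q : Matrix ι ι F, Q * P = 1 ∧ ∀ x, (P * M * Q) x x = γ x := by
  have main : ∀ N : Matrix ι ι F, N.trace = M.trace → (∃ i j, i ≠ j ∧ N j i ≠ 0) →
      ∃ P Q : Matrix ι ι F, Q * P = 1 ∧ ∀ x, (P * N * Q) x x = γ x := by
    rintro N hN ⟨i, j, hij, hN0⟩
    obtain ⟨P, Q, hQP, ⟨t, -, ht⟩, -⟩ := exists_conj_diag_eq_of_apply_ne_zero γ univ N i j
      (mem_univ _) (mem_univ _) hij hN0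
    refine ⟨P, Q, hQP, fun x => ?_⟩
    by_cases hx : x = t
    swap
    · exact ht x (mem_univ _) hx
    subst hx
    have h1 : (P * N * Q).trace = ∑ i, γ i := by
      rw [trace_mul_comm, ← mul_assoc, hQP, one_mul, hN, hγ]
    simp only [trace, diag_apply] at h1
    rw [← add_sum_erase _ _ (mem_univ x), ← add_sum_erase _ γ (mem_univ x),
      sum_congr rfl fun y hy => ht y (mem_univ _) (ne_of_mem_erase hy)] at h1
    exact add_right_cancel h1
  by_cases h : ∃ i j, i ≠ j ∧ M j i ≠ 0
  · exact main M rfl h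
  push Not at h
  have h' : ∃ i j, M i i ≠ M j j := by
    by_contra! h'
    rcases isEmpty_or_nonempty ι with hι | ⟨⟨i⟩⟩
    · exact hM 0 (Subsingleton.elim _ _)
    · refine hM (M i i) (Matrix.ext fun a b => ?_)
      by_cases hab : a = b
      · rw [hab, scalar_apply, diagonal_apply_eq, h']
      · rw [h b a (Ne.symm hab), scalar_apply, diagonal_apply_ne _ hab]
  obtain ⟨i, j, hij⟩ := h'
  have hne : i ≠ j := by rintro rfl; exact hij rfl
  -- For a diagonal matrix with two distinct entries, this conjugation creates the off-diagonal
  -- entry M j j - M i i.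
  refine exists_conj_of_conj_transvection (p := fun N => ∀ x, N x x = γ x) hne 1
    (main _ ?_ ⟨j, i, hne.symm, ?_⟩)
  · rw [trace_mul_comm, ← mul_assoc, transvection_mul_neg hne, one_mul]
  · rw [mul_transvection_apply_same, transvection_mul_apply_same, transvection_mul_apply_same,
      h j i hne.symm, h i j hne]
    intro h0
    exact hij (by linear_combination -h0)

end Conjugation

/-! ### Roots of triangular matrices. -/

section Roots

open Polynomial

variable {F : Type*} [Field F]

/-- If b^k is already a root of N, this is a Hensel lift f + tN: f(b^k) ≠ 0 and k ≠ 0 in F make the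
derivative invertible. Otherwise it is the Chinese remainder theorem, with value b imposed at b^k.
-/
theorem exists_dvd_pow_sub_X_mul {k : ℕ} (hk : (k : F) ≠ 0) {N f : F[X]} (hf : N ∣ f ^ k - X)
    {b : F} (hb : b ≠ 0) : ∃ g : F[X], (X - C (b ^ k)) * N ∣ g ^ k - X := by
  by_cases hN : (X - C (b ^ k)) ∣ N
  · obtain ⟨g, hg⟩ := hf
    have hN0 : N.eval (b ^ k) = 0 := dvd_iff_isRoot.mp hN
    have hk0 : k ≠ 0 := by rintro rfl; simp at hk
    have hfa : f.eval (b ^ k) ≠ 0 := by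
      intro h0
      have := congrArg (eval (b ^ k)) hg
      simp only [eval_sub, eval_pow, h0, eval_X, eval_mul, hN0, zero_mul, zero_pow hk0] at this
      exact pow_ne_zero k hb (by linear_combination -this)
    let t : F := -(g.eval (b ^ k) / (k * f.eval (b ^ k) ^ (k - 1)))
    obtain ⟨r, hr⟩ := powAddExpansion f (C t * N) k
    have hroot : (X - C (b ^ k)) ∣ g + (k : F[X]) * f ^ (k - 1) * C t + r * C t ^ 2 * N := by
      rw [dvd_iff_isRoot, IsRoot]
      have hne : (k : F) * f.eval (b ^ k) ^ (k - 1) ≠ 0 := mul_ne_zero hk (pow_ne_zero _ hfa)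
      simp only [eval_add, eval_mul, eval_natCast, eval_pow, eval_C, hN0, mul_zero, add_zero, t,
        mul_neg, mul_div_cancel₀ _ hne, add_neg_cancel]
    refine ⟨f + C t * N, ?_⟩
    have heq : (f + C t * N) ^ k - X =
        (g + (k : F[X]) * f ^ (k - 1) * C t + r * C t ^ 2 * N) * N := by
      rw [hr]
      linear_combination hg
    rw [heq]
    exact mul_dvd_mul_right hroot N
  · have hN0 : N.eval (b ^ k) ≠ 0 := fun h => hN (dvd_iff_isRoot.mpr h)
    refine ⟨f + C ((b - f.eval (b ^ k)) / N.eval (b ^ k)) * N, ?_⟩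
    refine IsCoprime.mul_dvd ?_ ?_ ?_
    · exact ((irreducible_X_sub_C _).coprime_iff_not_dvd).mpr hN
    · rw [dvd_iff_isRoot, IsRoot]
      simp [hN0]
    · have h1 : N ∣ (f + C ((b - f.eval (b ^ k)) / N.eval (b ^ k)) * N) ^ k - f ^ k :=
        (Dvd.intro_left (C ((b - f.eval (b ^ k)) / N.eval (b ^ k))) (by ring)).trans
          (sub_dvd_pow_sub_pow _ _ k)
      simpa using dvd_add h1 hf

theorem exists_dvd_pow_sub_X_prod {ι : Type*} {k : ℕ} (hk : (k : F) ≠ 0) {N f : F[X]}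
    (hf : N ∣ f ^ k - X) (b : ι → F) (s : Finset ι) (hb : ∀ i ∈ s, b i ≠ 0) :
    ∃ g : F[X], (∏ i ∈ s, (X - C (b i ^ k))) * N ∣ g ^ k - X := by
  classical
  induction s using Finset.induction_on with
  | empty => exact ⟨f, by simpa using hf⟩
  | insert i s hi ih =>
    obtain ⟨g, hg⟩ := ih fun j hj => hb j (Finset.mem_insert_of_mem hj)
    rw [Finset.prod_insert hi, mul_assoc]
    exact exists_dvd_pow_sub_X_mul hk hg (hb i (Finset.mem_insert_self i s))

-- A polynomial g with g^k ≡ X modulo the characteristic polynomial gives g(M)^k = M by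
-- Cayley–Hamilton.
open Matrix in
theorem exists_pow_eq_of_isUpperTriangular {n k : ℕ} (hk : (k : F) ≠ 0)
    {M : Matrix (Fin n) (Fin n) F} (hM : M.IsUpperTriangular) (h : ∀ i, ∃ b, b ^ k = M i i)
    (h0 : ∀ i j, M i i = 0 → M j j = 0 → i = j) : ∃ A : Matrix (Fin n) (Fin n) F, A ^ k = M := by
  have hk0 : k ≠ 0 := by rintro rfl; simp at hk
  choose b hb using h
  have key : ∃ g : F[X], M.charpoly ∣ g ^ k - X := by
    rw [charpoly_of_isUpperTriangular M hM]
    simp_rw [← hb]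
    by_cases hz : ∃ i, b i = 0
    · obtain ⟨i, hi⟩ := hz
      -- Lifting fails at the root 0, so its single factor X is taken as the starting modulus, with
      -- root 0 of X modulo X.
      obtain ⟨g, hg⟩ := exists_dvd_pow_sub_X_prod hk (N := X) (f := 0)
        (by rw [zero_pow hk0, zero_sub]; exact (dvd_refl X).neg_right) b (Finset.univ.erase i)
        (fun j hj hj0 => Finset.ne_of_mem_erase hj
          (h0 j i (by rw [← hb, hj0, zero_pow hk0]) (by rw [← hb, hi, zero_pow hk0])))
      refine ⟨g, ?_⟩
      rw [← Finset.mul_prod_erase _ _ (Finset.mem_univ i), hi, zero_pow hk0, C_0, sub_zero,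
        mul_comm]
      exact hg
    · push Not at hz
      obtain ⟨g, hg⟩ := exists_dvd_pow_sub_X_prod hk (N := 1) (f := 0) (one_dvd _) b
        Finset.univ fun i _ => hz i
      exact ⟨g, by rwa [mul_one] at hg⟩
  obtain ⟨g, r, hr⟩ := key
  refine ⟨aeval M g, ?_⟩
  have := congrArg (aeval M) hr
  rw [map_mul, aeval_self_charpoly, zero_mul, map_sub, map_pow, aeval_X] at this
  exact sub_eq_zero.mp this

end Roots

/-! ### Non-scalar matrices as a sum of two triangular powers. -/

open Matrix in
/-- A non-scalar matrix is a sum of two `k`-th powers as soon as its trace is a sum of `2n` `k`-th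
powers that can be arranged in two groups of `n` with at most one zero in each group. -/
theorem exists_pow_add_pow_eq_of_trace {F : Type*} [Field F] {n k : ℕ} (hk : (k : F) ≠ 0)
    {M : Matrix (Fin n) (Fin n) F} (hM : ∀ c, M ≠ scalar (Fin n) c) {a b : Fin n → F}
    (ha : ∀ i, ∃ x, x ^ k = a i) (hb : ∀ i, ∃ x, x ^ k = b i)
    (ha0 : ∀ i j, a i = 0 → a j = 0 → i = j) (hb0 : ∀ i j, b i = 0 → b j = 0 → i = j)
    (htr : ∑ i, a i + ∑ i, b i = M.trace) :
    ∃ A B : Matrix (Fin n) (Fin n) F, A ^ k + B ^ k = M := by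
  obtain ⟨P, Q, hQP, hdiag⟩ := exists_conj_diag_eq_of_trace_eq hM (γ := fun i => a i + b i)
    (by rw [Finset.sum_add_distrib, htr])
  have hPQ : P * Q = 1 := mul_eq_one_comm.mp hQP
  let U : Matrix (Fin n) (Fin n) F := of fun i j =>
    if i = j then a i else if i < j then (P * M * Q) i j else 0
  let L : Matrix (Fin n) (Fin n) F := of fun i j =>
    if i = j then b i else if i < j then 0 else (P * M * Q) i j
  have hUL : U + L = P * M * Q := by
    ext i j
    simp only [U, L, Matrix.add_apply, of_apply]
    split_ifs with h1 h2
    · rw [← h1, hdiag]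
    · rw [add_zero]
    · rw [zero_add]
  obtain ⟨A, hA⟩ := exists_pow_eq_of_isUpperTriangular hk (M := U)
    (fun i j hij => by
      have h : j < i := hij
      simp [U, h.ne', h.not_gt])
    (by simpa [U] using ha) (by simpa [U] using ha0)
  -- The lower triangular part is reached by transposition, which commutes with powers.
  obtain ⟨B, hB⟩ := exists_pow_eq_of_isUpperTriangular hk (M := Lᵀ)
    (fun i j hij => by
      have h : j < i := hij
      simp [L, h.ne, h])
    (by simpa [L] using hb) (by simpa [L] using hb0)
  have hpow : ∀ (X : Matrix (Fin n) (Fin n) F) (l : ℕ), (Q * X * P) ^ l = Q * X ^ l * P := by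
    intro X l
    induction l with
    | zero => rw [pow_zero, pow_zero, mul_one, hQP]
    | succ l ih =>
      calc (Q * X * P) ^ (l + 1) = Q * X ^ l * (P * Q) * (X * P) := by
            rw [pow_succ, ih]; simp only [mul_assoc]
        _ = _ := by rw [hPQ, mul_one, pow_succ]; simp only [mul_assoc]
  refine ⟨Q * A * P, Q * Bᵀ * P, ?_⟩
  rw [hpow, hpow, ← transpose_pow, hA, hB, transpose_transpose, ← add_mul, ← mul_add, hUL]
  calc Q * (P * M * Q) * P = (Q * P) * M * (Q * P) := by simp only [mul_assoc]
    _ = M := by rw [hQP, one_mul, mul_one]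

/-! ### Growth of sums of roots of unity. -/

section Growth

open Finset
open scoped Pointwise

variable {F : Type*} [Field F] [Fintype F] [DecidableEq F] {m : ℕ}

/-- The `m`-th roots of unity in a finite field. -/
def unityRoots (F : Type*) [Field F] [Fintype F] [DecidableEq F] (m : ℕ) : Finset F :=
  {y : F | y ^ m = 1}

theorem mem_unityRoots {y : F} : y ∈ unityRoots F m ↔ y ^ m = 1 := by
  simp [unityRoots]

theorem one_mem_unityRoots : (1 : F) ∈ unityRoots F m := mem_unityRoots.mpr (one_pow m)

theorem ne_zero_of_mem_unityRoots (hm : m ≠ 0) {y : F} (hy : y ∈ unityRoots F m) : y ≠ 0 := by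
  rintro rfl
  rw [mem_unityRoots, zero_pow hm] at hy
  exact zero_ne_one hy

theorem card_unityRoots_le (hm : m ≠ 0) : (unityRoots F m).card ≤ m := by
  have h : (unityRoots F m).val ≤ Polynomial.nthRoots m (1 : F) :=
    Multiset.le_iff_subset (unityRoots F m).nodup |>.mpr fun y hy =>
      (Polynomial.mem_nthRoots (Nat.pos_of_ne_zero hm)).mpr (mem_unityRoots.mp hy)
  exact (Multiset.card_le_card h).trans (Polynomial.card_nthRoots _ _)

theorem exists_pow_ne_one (hm : m ≠ 0) (hH : (unityRoots F m).card = m) {i : ℕ} (hi : ¬ m ∣ i) :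
    ∃ h ∈ unityRoots F m, h ^ i ≠ 1 := by
  by_contra! hall
  have hsub : unityRoots F m ⊆ unityRoots F (Nat.gcd i m) := fun h hh =>
    mem_unityRoots.mpr (by
      rw [← orderOf_dvd_iff_pow_eq_one]
      exact Nat.dvd_gcd (orderOf_dvd_of_pow_eq_one (hall h hh))
        (orderOf_dvd_of_pow_eq_one (mem_unityRoots.mp hh)))
  have h1 := (card_le_card hsub).trans (card_unityRoots_le (Nat.gcd_ne_zero_right hm))
  rw [hH] at h1
  have h2 : Nat.gcd i m = m := le_antisymm (Nat.gcd_le_right _ (Nat.pos_of_ne_zero hm)) h1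
  exact hi (h2 ▸ Nat.gcd_dvd_left i m)

/-- `T` is a union of orbits of the `m`-th roots of unity acting by multiplication. -/
def MulStable (m : ℕ) (T : Finset F) : Prop := ∀ h ∈ unityRoots F m, ∀ t ∈ T, h * t ∈ T

theorem mulStable_unityRoots : MulStable m (unityRoots F m) := fun h hh t ht => by
  rw [mem_unityRoots] at *
  rw [mul_pow, hh, ht, one_mul]

theorem mulStable_zero : MulStable m ({0} : Finset F) := fun h _ t ht => by
  rw [mem_singleton] at *
  rw [ht, mul_zero]

theorem MulStable.add {T U : Finset F} (hT : MulStable m T) (hU : MulStable m U) :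
    MulStable m (T + U) := fun h hh x hx => by
  obtain ⟨t, ht, u, hu, rfl⟩ := mem_add.mp hx
  rw [mul_add]
  exact add_mem_add (hT h hh t ht) (hU h hh u hu)

theorem MulStable.union {T U : Finset F} (hT : MulStable m T) (hU : MulStable m U) :
    MulStable m (T ∪ U) := fun h hh x hx => by
  rcases mem_union.mp hx with hx | hx
  · exact mem_union_left _ (hT h hh x hx)
  · exact mem_union_right _ (hU h hh x hx)

theorem MulStable.image_mul {T : Finset F} (hm : m ≠ 0) (hT : MulStable m T) {h : F}
    (hh : h ∈ unityRoots F m) : T.image (h * ·) = T :=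
  eq_of_subset_of_card_le (fun x hx => by
      obtain ⟨t, ht, rfl⟩ := mem_image.mp hx
      exact hT h hh t ht)
    (card_image_of_injective _ (mul_right_injective₀ (ne_zero_of_mem_unityRoots hm hh))).ge

/-- Multiplication by a root h with h^i ≠ 1 permutes T and scales the sum by h^i. -/
theorem MulStable.sum_pow_eq_zero {T : Finset F} (hm : m ≠ 0) (hH : (unityRoots F m).card = m)
    (hT : MulStable m T) {i : ℕ} (hi : ¬ m ∣ i) : ∑ t ∈ T, t ^ i = 0 := by
  obtain ⟨h, hh, hne⟩ := exists_pow_ne_one hm hH hi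
  have h1 : ∑ t ∈ T, t ^ i = h ^ i * ∑ t ∈ T, t ^ i := by
    conv_lhs => rw [← hT.image_mul hm hh]
    rw [sum_image (fun x _ y _ hxy => mul_right_injective₀ (ne_zero_of_mem_unityRoots hm hh) hxy),
      mul_sum]
    simp_rw [mul_pow]
  exact eq_zero_of_mul_eq_self_left hne h1.symm

theorem MulStable.dvd_card_erase {T : Finset F} (hm : m ≠ 0) (hH : (unityRoots F m).card = m)
    (hT : MulStable m T) : m ∣ (T.erase 0).card := by
  rw [card_eq_sum_card_image (· ^ m)]
  refine dvd_sum fun z hz => ?_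
  obtain ⟨y, hy, rfl⟩ := mem_image.mp hz
  have hy0 : y ≠ 0 := ne_of_mem_erase hy
  have h1 : {x ∈ T.erase 0 | x ^ m = y ^ m} = (unityRoots F m).image (· * y) := by
    ext x
    simp only [mem_filter, mem_image]
    constructor
    · rintro ⟨-, hx⟩
      exact ⟨x / y, mem_unityRoots.mpr (by rw [div_pow, hx, div_self (pow_ne_zero _ hy0)]),
        div_mul_cancel₀ _ hy0⟩
    · rintro ⟨h, hh, rfl⟩
      refine ⟨mem_erase.mpr ⟨mul_ne_zero (ne_zero_of_mem_unityRoots hm hh) hy0,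
        hT h hh y (mem_of_mem_erase hy)⟩, ?_⟩
      rw [mul_pow, mem_unityRoots.mp hh, one_mul]
  rw [h1, card_image_of_injective _ (mul_left_injective₀ hy0), hH]

/-- A nonempty set that does not grow under addition of the roots of unity is everything. -/
theorem eq_univ_of_card_add_unityRoots_le {T : Finset F} (hH : 2 ≤ (unityRoots F m).card)
    (hgen : ∀ V : AddSubmonoid F, (∀ h ∈ unityRoots F m, h ∈ V) → V = ⊤)
    (hne : T.Nonempty) (hc : (T + unityRoots F m).card ≤ T.card) : T = univ := by
  have key : ∀ h ∈ unityRoots F m, ∀ h' ∈ unityRoots F m, ∀ t ∈ T, t + (h - h') ∈ T := by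
    intro h hh h' hh' t ht
    have h1 : T.image (· + h') = T + unityRoots F m :=
      eq_of_subset_of_card_le (fun x hx => by
          obtain ⟨y, hy, rfl⟩ := mem_image.mp hx
          exact add_mem_add hy hh')
        (by rwa [card_image_of_injective _ (add_left_injective h')])
    have h2 : t + h ∈ T.image (· + h') := h1 ▸ add_mem_add ht hh
    obtain ⟨y, hy, hyt⟩ := mem_image.mp h2
    have h3 : t + (h - h') = y := by linear_combination -hyt
    rwa [h3]
  obtain ⟨a, ha, ha1⟩ := exists_mem_ne (by omega : 1 < (unityRoots F m).card) 1
  have ha1' : a - 1 ≠ 0 := sub_ne_zero.mpr ha1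
  -- T is stable under translation by every h - h', in particular by ha - h = h(a - 1). Hence V
  -- contains all roots, so it is everything, and T is stable under every translation.
  let V : AddSubmonoid F :=
    { carrier := {v | ∀ t ∈ T, t + v * (a - 1) ∈ T}
      zero_mem' := fun t ht => by rwa [zero_mul, add_zero]
      add_mem' := fun {v w} hv hw t ht => by
        rw [add_mul, ← add_assoc]
        exact hw _ (hv t ht) }
  have hV : V = ⊤ := hgen V fun h hh t ht => by
    have := key (h * a) (mulStable_unityRoots h hh a ha) h hh t ht
    rwa [show h * (a - 1) = h * a - h by ring]
  obtain ⟨t, ht⟩ := hne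
  refine eq_univ_of_forall fun x => ?_
  have hx : (x - t) / (a - 1) ∈ V := hV ▸ AddSubmonoid.mem_top _
  have := hx t ht
  rwa [div_mul_cancel₀ _ ha1', add_sub_cancel] at this

/-- Write T + H as T + 1 plus one further element f. Since m ≥ 3, the first and second power sums of
T and T + H vanish, which forces f² = f. As -1 ∈ T, zero lies in T + 1, so f = 1. Then H ⊆ T + H,
and T ∪ {0} does not grow when H is added. -/
theorem MulStable.add_eq_univ_of_card_add_eq_succ {T : Finset F} (hm : 3 ≤ m)
    (hH : (unityRoots F m).card = m)
    (hgen : ∀ V : AddSubmonoid F, (∀ h ∈ unityRoots F m, h ∈ V) → V = ⊤)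
    (hT : MulStable m T) (h0 : 0 ∉ T) (h0' : 0 ∈ T + unityRoots F m)
    (hc : (T + unityRoots F m).card = T.card + 1) : T + unityRoots F m = univ := by
  have hm0 : m ≠ 0 := by omega
  have hR : MulStable m (T + unityRoots F m) := hT.add mulStable_unityRoots
  have hsub : T.image (· + 1) ⊆ T + unityRoots F m := fun x hx => by
    obtain ⟨t, ht, rfl⟩ := mem_image.mp hx
    exact add_mem_add ht one_mem_unityRoots
  have hinj : Function.Injective (· + (1 : F)) := add_left_injective 1
  obtain ⟨f, hf⟩ := card_eq_one.mp (show ((T + unityRoots F m) \ T.image (· + 1)).card = 1 by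
    rw [card_sdiff_of_subset hsub, hc, card_image_of_injective _ hinj]; omega)
  have hsum : ∀ i, ∑ y ∈ T + unityRoots F m, y ^ i = f ^ i + ∑ t ∈ T, (t + 1) ^ i := fun i => by
    rw [← sum_sdiff hsub, hf, sum_singleton, sum_image fun x _ y _ h => hinj h]
  have hfm : f ∈ T + unityRoots F m ∧ f ∉ T.image (· + 1) :=
    mem_sdiff.mp (hf ▸ mem_singleton_self f)
  have h1 : ¬ m ∣ 1 := fun h => by have := Nat.le_of_dvd one_pos h; omega
  have h2 : ¬ m ∣ 2 := fun h => by have := Nat.le_of_dvd two_pos h; omega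
  have hR1 := hR.sum_pow_eq_zero hm0 hH h1
  have hR2 := hR.sum_pow_eq_zero hm0 hH h2
  have hT1 := hT.sum_pow_eq_zero hm0 hH h1
  have hT2 := hT.sum_pow_eq_zero hm0 hH h2
  rw [hsum] at hR1 hR2
  simp only [pow_one, sum_add_distrib, sum_const, nsmul_eq_mul, mul_one] at hR1 hT1
  simp only [add_sq, mul_one, one_pow, sum_add_distrib, sum_const, nsmul_eq_mul]
    at hR2
  rw [← mul_sum] at hR2
  have hff : f * (f - 1) = 0 := by linear_combination hR2 - hT2 - 2 * hT1 - hR1 + hT1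
  have hf0 : f ≠ 0 := by
    rintro rfl
    obtain ⟨t, ht, h, hh, hth⟩ := mem_add.mp h0'
    have hh0 := ne_zero_of_mem_unityRoots hm0 hh
    refine hfm.2 (mem_image.mpr ⟨h⁻¹ * t, hT _ ?_ t ht, ?_⟩)
    · rw [mem_unityRoots, inv_pow, mem_unityRoots.mp hh, inv_one]
    · field_simp
      rw [hth, mul_zero]
  have hf1 : f = 1 := by
    rcases mul_eq_zero.mp hff with h | h
    · exact absurd h hf0
    · exact sub_eq_zero.mp h
  rw [hf1] at hfm
  have hle : (insert 0 T + unityRoots F m) ⊆ T + unityRoots F m := fun x hx => by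
    obtain ⟨t, ht, h, hh, rfl⟩ := mem_add.mp hx
    rcases mem_insert.mp ht with rfl | ht
    · simpa using hR h hh 1 hfm.1
    · exact add_mem_add ht hh
  have huniv := eq_univ_of_card_add_unityRoots_le (by omega) hgen (insert_nonempty _ _) (by
    rw [card_insert_of_notMem h0, ← hc]
    exact card_le_card hle)
  refine eq_univ_of_card _ ?_
  rw [hc, ← card_insert_of_notMem h0, huniv, card_univ]

/-- Nonzero elements come in orbits of size m. If no orbit is gained, zero is the only new element,
the case just excluded. -/
theorem MulStable.card_erase_add_le {T : Finset F} (hm : 3 ≤ m) (hH : (unityRoots F m).card = m)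
    (hgen : ∀ V : AddSubmonoid F, (∀ h ∈ unityRoots F m, h ∈ V) → V = ⊤)
    (hT : MulStable m T) (hne : T.Nonempty) :
    T + unityRoots F m = univ ∨ (T.erase 0).card + m ≤ ((T + unityRoots F m).erase 0).card := by
  by_contra! hcon
  obtain ⟨hR, hlt⟩ := hcon
  have hm0 : m ≠ 0 := by omega
  have hle : ((T + unityRoots F m).erase 0).card ≤ (T.erase 0).card := by
    obtain ⟨a, ha⟩ := hT.dvd_card_erase hm0 hH
    obtain ⟨b, hb⟩ := (hT.add mulStable_unityRoots).dvd_card_erase hm0 hH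
    rw [ha, hb] at hlt ⊢
    have : b < a + 1 := by
      refine lt_of_mul_lt_mul_left (a := m) ?_ (Nat.zero_le m)
      linarith
    exact Nat.mul_le_mul_left m (by omega)
  have hgrow : T.card < (T + unityRoots F m).card := by
    by_contra! hc
    have hu := eq_univ_of_card_add_unityRoots_le (by omega) hgen hne hc
    refine hR (eq_univ_of_forall fun x => ?_)
    have := add_mem_add (hu ▸ mem_univ (x - 1) : x - 1 ∈ T) (one_mem_unityRoots (m := m))
    rwa [sub_add_cancel] at this
  have h1 : (T + unityRoots F m).card ≤ ((T + unityRoots F m).erase 0).card + 1 :=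
    by have := pred_card_le_card_erase (s := T + unityRoots F m) (a := 0); omega
  have h0 : 0 ∉ T := fun h => by
    have := card_erase_add_one h
    omega
  have h0' : 0 ∈ T + unityRoots F m := by
    by_contra h
    rw [erase_eq_of_notMem h] at hle
    have := card_erase_le (s := T) (a := 0)
    omega
  rw [erase_eq_of_notMem h0] at hle
  exact hR (hT.add_eq_univ_of_card_add_eq_succ hm hH hgen h0 h0' (by omega))

/-- The set of sums of exactly `s` roots of unity. -/
def unityRootSums (F : Type*) [Field F] [Fintype F] [DecidableEq F] (m : ℕ) : ℕ → Finset F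
  | 0 => {0}
  | s + 1 => unityRootSums F m s + unityRoots F m

theorem mulStable_unityRootSums (s : ℕ) : MulStable m (unityRootSums F m s) := by
  induction s with
  | zero => exact mulStable_zero
  | succ s ih => exact ih.add mulStable_unityRoots

theorem unityRootSums_nonempty (s : ℕ) : (unityRootSums F m s).Nonempty := by
  induction s with
  | zero => exact singleton_nonempty 0
  | succ s ih => exact ih.add ⟨1, one_mem_unityRoots⟩

theorem unityRootSums_one : unityRootSums F m 1 = unityRoots F m := by
  change {0} + unityRoots F m = _
  rw [singleton_zero, zero_add]

theorem unityRootSums_add (s t : ℕ) :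
    unityRootSums F m (s + t) = unityRootSums F m s + unityRootSums F m t := by
  induction t with
  | zero => change _ = _ + {0}; rw [singleton_zero, add_zero, add_zero]
  | succ t ih =>
    change unityRootSums F m (s + t) + _ = _ + (unityRootSums F m t + _)
    rw [ih, add_assoc]

theorem MulStable.mul_le_card_erase_add {T : Finset F} {c d : ℕ} (hm : 3 ≤ m)
    (hH : (unityRoots F m).card = m) (hcard : Fintype.card F = m * d + 1)
    (hgen : ∀ V : AddSubmonoid F, (∀ h ∈ unityRoots F m, h ∈ V) → V = ⊤)
    (hT : MulStable m T) (hne : T.Nonempty) (hc : c * m ≤ (T.erase 0).card) (s : ℕ) (hs : c + s ≤ d) :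
    (c + s) * m ≤ ((T + unityRootSums F m s).erase 0).card := by
  induction s with
  | zero =>
    change _ ≤ ((T + {0}).erase 0).card
    rwa [singleton_zero, add_zero, add_zero]
  | succ s ih =>
    have ih := ih (by omega)
    change _ ≤ ((T + (unityRootSums F m s + unityRoots F m)).erase 0).card
    rw [← add_assoc T]
    rcases (hT.add (mulStable_unityRootSums s)).card_erase_add_le hm hH hgen
      (hne.add (unityRootSums_nonempty s)) with h | h
    · rw [h, card_erase_of_mem (mem_univ _), card_univ, hcard, Nat.add_sub_cancel, mul_comm]
      exact Nat.mul_le_mul_left m hs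
    · calc (c + (s + 1)) * m = (c + s) * m + m := by ring
        _ ≤ _ := by omega

theorem mem_of_mul_le_card_erase {T : Finset F} {d : ℕ} (hcard : Fintype.card F = m * d + 1)
    (hT : d * m ≤ (T.erase 0).card) {x : F} (hx : x ≠ 0) : x ∈ T := by
  have h : T.erase 0 = univ.erase 0 := eq_of_subset_of_card_le (erase_subset_erase 0 (subset_univ T))
    (by rwa [card_erase_of_mem (mem_univ _), card_univ, hcard, Nat.add_sub_cancel, mul_comm])
  exact mem_of_mem_erase (h ▸ mem_erase.mpr ⟨hx, mem_univ x⟩ : x ∈ T.erase 0)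

theorem mem_unityRootSums_of_ne_zero {d : ℕ} (hm : 3 ≤ m)
    (hH : (unityRoots F m).card = m) (hcard : Fintype.card F = m * d + 1)
    (hgen : ∀ V : AddSubmonoid F, (∀ h ∈ unityRoots F m, h ∈ V) → V = ⊤)
    {x : F} (hx : x ≠ 0) : x ∈ unityRootSums F m d := by
  refine mem_of_mul_le_card_erase hcard ?_ hx
  have := (mulStable_zero (F := F) (m := m)).mul_le_card_erase_add (c := 0) hm hH hcard hgen
    (singleton_nonempty 0) (by simp) d (by omega)
  rwa [singleton_zero, zero_add, zero_add] at this

theorem unityRootSums_eq_univ {d s : ℕ} (hm : 3 ≤ m)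
    (hH : (unityRoots F m).card = m) (hcard : Fintype.card F = m * d + 1)
    (hgen : ∀ V : AddSubmonoid F, (∀ h ∈ unityRoots F m, h ∈ V) → V = ⊤)
    (hs : d + 1 ≤ s) : unityRootSums F m s = univ := by
  refine eq_univ_of_forall fun x => ?_
  induction s, hs using Nat.le_induction generalizing x with
  | base =>
    obtain ⟨h, hh, hne⟩ := exists_mem_ne (by omega : 1 < (unityRoots F m).card) x
    have := add_mem_add
      (mem_unityRootSums_of_ne_zero hm hH hcard hgen (sub_ne_zero.mpr hne.symm)) hh
    rwa [sub_add_cancel] at this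
  | succ s _ ih =>
    have := add_mem_add (ih (x - 1)) (one_mem_unityRoots (m := m))
    rwa [sub_add_cancel] at this

/-- Each summand adds at least one element until F is filled. This weaker growth covers m = 2. -/
theorem unityRootSums_eq_univ_of_card_le (hH : 2 ≤ (unityRoots F m).card)
    (hgen : ∀ V : AddSubmonoid F, (∀ h ∈ unityRoots F m, h ∈ V) → V = ⊤)
    {s : ℕ} (hs : Fintype.card F ≤ s + 1) : unityRootSums F m s = univ := by
  have key : ∀ s, min (s + 1) (Fintype.card F) ≤ (unityRootSums F m s).card := by
    intro s
    induction s with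
    | zero => exact (min_le_left _ _).trans (unityRootSums_nonempty 0).card_pos
    | succ s ih =>
      change _ ≤ (unityRootSums F m s + unityRoots F m).card
      by_cases hc : (unityRootSums F m s + unityRoots F m).card ≤ (unityRootSums F m s).card
      · have hu := eq_univ_of_card_add_unityRoots_le hH hgen
          (unityRootSums_nonempty s) hc
        have := card_le_card_add_right (s := unityRootSums F m s)
          (⟨1, one_mem_unityRoots⟩ : (unityRoots F m).Nonempty)
        rw [hu, card_univ] at this
        rw [hu]
        exact (min_le_right _ _).trans this
      · omega
  refine eq_univ_of_card _ (le_antisymm (card_le_univ _) ?_)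
  have := key s
  omega

end Growth

/-! ### Representing zero in the boundary case d = 2n. -/

section ZeroSum

open Finset
open scoped Pointwise

variable {F : Type*} [Field F] [Fintype F] [DecidableEq F] {m : ℕ}

theorem sum_unityRoots_pow (hm : m ≠ 0) (hH : (unityRoots F m).card = m) (i : ℕ) :
    ∑ h ∈ unityRoots F m, h ^ i = if m ∣ i then (m : F) else 0 := by
  split_ifs with hi
  · obtain ⟨c, rfl⟩ := hi
    rw [sum_congr rfl fun h hh => by rw [pow_mul, mem_unityRoots.mp hh, one_pow], sum_const, hH,
      nsmul_eq_mul, mul_one]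
  · exact mulStable_unityRoots.sum_pow_eq_zero hm hH hi

theorem sum_unityRoots_pow_mul_add_one_pow (hm : m ≠ 0) (hH : (unityRoots F m).card = m)
    (e N : ℕ) {I : Finset ℕ} (hI : ∀ i, i ∈ I ↔ i ≤ N ∧ m ∣ i + e) :
    ∑ h ∈ unityRoots F m, h ^ e * (h + 1) ^ N = m * ∑ i ∈ I, (N.choose i : F) := by
  have h1 : I = {i ∈ range (N + 1) | m ∣ i + e} := by
    ext i
    rw [hI, mem_filter, mem_range, Nat.lt_succ_iff]
  simp_rw [add_pow, one_pow, mul_one, mul_sum]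
  rw [sum_comm, h1, sum_filter]
  refine sum_congr rfl fun i _ => ?_
  calc ∑ h ∈ unityRoots F m, h ^ e * (h ^ i * (N.choose i : F))
      = (∑ h ∈ unityRoots F m, h ^ (i + e)) * (N.choose i : F) := by
        rw [sum_mul]
        exact sum_congr rfl fun h _ => by ring
    _ = _ := by
        rw [sum_unityRoots_pow hm hH]
        split_ifs <;> simp

theorem dvd_add_sub_iff {j : ℕ} (hj : j < m) {i : ℕ} (hi : i ≤ 2 * m) :
    m ∣ i + (m - j) ↔ i = j ∨ i = m + j ∨ i = 2 * m + j := by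
  constructor
  · rintro ⟨c, hc⟩
    have h1 : c < 4 := by
      by_contra! h
      have := Nat.mul_le_mul_left m h
      omega
    interval_cases c <;> omega
  · rintro (rfl | rfl | rfl)
    · exact ⟨1, by omega⟩
    · exact ⟨2, by omega⟩
    · exact ⟨3, by omega⟩

/-- If `(1 + h) ^ m` takes only the values `1` and `u` on the `m`-th roots of unity, then
`u = -1`. -/
theorem eq_neg_one_of_add_one_pow (hm : 3 ≤ m) (hH : (unityRoots F m).card = m)
    (hmF : (m : F) ≠ 0) (h2 : (2 : F) ≠ 0) {u : F} (hu0 : u ≠ 0)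
    (hu : ∀ h ∈ unityRoots F m, (h + 1) ^ m = 1 ∨ (h + 1) ^ m = u) : u = -1 := by
  have hm0 : m ≠ 0 := by omega
  -- Expand ((h+1)^m - 1)((h+1)^m - u) = 0, weight by h^e and sum over h. With e = m - j only
  -- binomial coefficients of index congruent to j modulo m survive; j = 0, 1, 2 will be used.
  have hsum : ∀ e, ∑ h ∈ unityRoots F m, h ^ e * (h + 1) ^ (2 * m)
      - (1 + u) * ∑ h ∈ unityRoots F m, h ^ e * (h + 1) ^ m
      + u * ∑ h ∈ unityRoots F m, h ^ e * (h + 1) ^ 0 = 0 := by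
    intro e
    rw [mul_sum, mul_sum, ← sum_sub_distrib, ← sum_add_distrib]
    refine sum_eq_zero fun h hh => ?_
    have h3 : ((h + 1) ^ m - 1) * ((h + 1) ^ m - u) = 0 := by
      rcases hu h hh with h4 | h4 <;> rw [h4] <;> ring
    rw [mul_comm 2 m, pow_mul]
    linear_combination h ^ e * h3
  have e0 := hsum (m - 0)
  rw [sum_unityRoots_pow_mul_add_one_pow hm0 hH (m - 0) (2 * m) (I := {0, m, 2 * m})
      (fun i => by
        simp only [mem_insert, mem_singleton]
        constructor
        · intro h
          have hi : i ≤ 2 * m := by omega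
          exact ⟨hi, (dvd_add_sub_iff (by omega) hi).mpr (by omega)⟩
        · rintro ⟨hi, h⟩
          have := (dvd_add_sub_iff (by omega) hi).mp h
          omega),
    sum_unityRoots_pow_mul_add_one_pow hm0 hH (m - 0) m (I := {0, m})
      (fun i => by
        simp only [mem_insert, mem_singleton]
        constructor
        · intro h
          have hi : i ≤ m := by omega
          exact ⟨hi, (dvd_add_sub_iff (by omega) (by omega)).mpr (by omega)⟩
        · rintro ⟨hi, h⟩
          have := (dvd_add_sub_iff (by omega) (by omega)).mp h
          omega),
    sum_unityRoots_pow_mul_add_one_pow hm0 hH (m - 0) 0 (I := {0})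
      (fun i => by
        simp only [mem_singleton]
        constructor
        · rintro rfl
          exact ⟨le_rfl, by simp⟩
        · rintro ⟨hi, -⟩
          omega)] at e0
  have ej : ∀ j, 0 < j → j < m → (((2 * m).choose j : F) + ((2 * m).choose (m + j) : F)) =
      (1 + u) * (m.choose j : F) := by
    intro j hj hjm
    have e := hsum (m - j)
    rw [sum_unityRoots_pow_mul_add_one_pow hm0 hH (m - j) (2 * m) (I := {j, m + j})
        (fun i => by
          simp only [mem_insert, mem_singleton]
          constructor
          · intro h
            have hi : i ≤ 2 * m := by omega
            exact ⟨hi, (dvd_add_sub_iff hjm hi).mpr (by omega)⟩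
          · rintro ⟨hi, h⟩
            have := (dvd_add_sub_iff hjm hi).mp h
            omega),
      sum_unityRoots_pow_mul_add_one_pow hm0 hH (m - j) m (I := {j})
        (fun i => by
          simp only [mem_singleton]
          constructor
          · intro h
            have hi : i ≤ m := by omega
            exact ⟨hi, (dvd_add_sub_iff hjm (by omega)).mpr (by omega)⟩
          · rintro ⟨hi, h⟩
            have := (dvd_add_sub_iff hjm (by omega)).mp h
            omega),
      sum_unityRoots_pow_mul_add_one_pow hm0 hH (m - j) 0 (I := ∅)
        (fun i => by
          simp only [notMem_empty, false_iff, not_and]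
          intro hi h
          have := (dvd_add_sub_iff hjm (by omega)).mp h
          omega), sum_pair (by omega), sum_singleton, sum_empty] at e
    refine mul_left_cancel₀ hmF ?_
    linear_combination e
  rw [sum_insert (by simp; omega), sum_pair (by omega), sum_pair (by omega), sum_singleton] at e0
  simp only [Nat.choose_zero_right, Nat.choose_self, Nat.cast_one] at e0
  have e1 := ej 1 one_pos (by omega)
  have e2 := ej 2 two_pos (by omega)
  have c1 : ((2 * m).choose (m + 1) : F) * (m + 1) = ((2 * m).choose m : F) * m := by
    have := Nat.choose_succ_right_eq (2 * m) m
    rw [show 2 * m - m = m by omega] at this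
    have h3 := congrArg (Nat.cast : ℕ → F) this
    push_cast at h3
    exact h3
  have c2 : ((2 * m).choose (m + 2) : F) * (m + 2) = ((2 * m).choose (m + 1) : F) * (m - 1) := by
    have := Nat.choose_succ_right_eq (2 * m) (m + 1)
    rw [show 2 * m - (m + 1) = m - 1 by omega] at this
    have h3 := congrArg (Nat.cast : ℕ → F) this
    push_cast [Nat.cast_sub (show 1 ≤ m by omega)] at h3
    linear_combination h3
  have d : ∀ N : ℕ, 1 ≤ N → (N.choose 2 : F) * 2 = N * (N - 1) := fun N hN => by
    have := Nat.choose_succ_right_eq N 1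
    rw [Nat.choose_one_right] at this
    have h3 := congrArg (Nat.cast : ℕ → F) this
    push_cast [Nat.cast_sub hN] at h3
    linear_combination h3
  have d1 := d m (by omega)
  have d2 := d (2 * m) (by omega)
  rw [Nat.choose_one_right, Nat.choose_one_right] at e1
  push_cast at e1 d2
  have hC : ((2 * m).choose m : F) = u := by
    refine mul_left_cancel₀ hmF ?_
    linear_combination e0
  rw [hC] at c1
  have hum : u * m = m + 1 := by
    refine mul_left_cancel₀ hmF ?_
    linear_combination c1 - (m + 1 : F) * e1
  have hm1 : (m : F) + 1 ≠ 0 := hum ▸ mul_ne_zero hu0 hmF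
  have hX : ((2 * m).choose (m + 1) : F) = 1 := by linear_combination e1 + hum
  -- The relations for j = 0, 1 gave um = m + 1. The one for j = 2 now yields 2m + 1 = 0, so um = m
  -- + 1 = -m.
  have hfin : (m : F) * (m * ((m + 1) * (2 * m + 1))) = 0 := by
    linear_combination 2 * m * (m + 2) * e2 - m * (m + 2) * d2 - 2 * m * (c2 + (m - 1 : F) * hX) +
      (1 + u) * m * (m + 2) * d1 + m * (m - 1) * (m + 2) * hum
  have h2m : 2 * (m : F) + 1 = 0 := by
    simpa [hmF, hm1] using hfin
  refine mul_left_cancel₀ hmF (mul_left_cancel₀ h2 ?_)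
  linear_combination 2 * hum + 2 * h2m

/-- Zero is a sum of `d` terms which are roots of unity, up to two of them replaced by zero. -/
theorem zero_mem_add_add_unityRootSums {d : ℕ} (hm : 3 ≤ m) (hH : (unityRoots F m).card = m)
    (hcard : Fintype.card F = m * d + 1)
    (hgen : ∀ V : AddSubmonoid F, (∀ h ∈ unityRoots F m, h ∈ V) → V = ⊤)
    (hd : 4 ≤ d) (hneg : (-1 : F) ∉ unityRoots F m) :
    (0 : F) ∈ insert 0 (unityRoots F m) + insert 0 (unityRoots F m) +
      unityRootSums F m (d - 2) := by
  have hm0 : m ≠ 0 := by omega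
  set A := insert 0 (unityRoots F m) with hA
  have h0A : (0 : F) ∈ A := mem_insert_self _ _
  have hHA : unityRoots F m ⊆ A := subset_insert _ _
  have hAst : MulStable m A := by
    rw [hA, insert_eq]
    exact mulStable_zero.union mulStable_unityRoots
  have hAne : A.Nonempty := ⟨0, h0A⟩
  set S2 := unityRoots F m + unityRoots F m with hS2
  have hS2st : MulStable m S2 := mulStable_unityRoots.add mulStable_unityRoots
  have hS2A : S2 ⊆ A + A := add_subset_add hHA hHA
  -- With three orbits in A + A, d - 3 more roots reach -1, and the last root 1 cancels it.
  by_cases hbig : 3 * m ≤ ((A + A).erase 0).card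
  · have h1 := (hAst.add hAst).mul_le_card_erase_add hm hH hcard hgen (hAne.add hAne) hbig (d - 3)
      (by omega)
    rw [show 3 + (d - 3) = d by omega] at h1
    have h2 := mem_of_mul_le_card_erase hcard h1 (neg_ne_zero.mpr (one_ne_zero (α := F)))
    have h3 := add_mem_add h2 (one_mem_unityRoots (m := m))
    rw [neg_add_cancel, add_assoc] at h3
    rwa [show d - 2 = (d - 3) + 1 by omega]
  have hAA : ((A + A).erase 0).card ≤ 2 * m := by
    obtain ⟨c, hc⟩ := (hAst.add hAst).dvd_card_erase hm0 hH
    rw [hc, mul_comm] at hbig ⊢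
    have : c < 3 := by
      by_contra! h
      exact hbig (Nat.mul_le_mul_left m h)
    exact Nat.mul_le_mul_right m (by omega)
  have hS2card : 2 * m ≤ (S2.erase 0).card := by
    have h1 := (mulStable_unityRoots (F := F)).mul_le_card_erase_add hm hH hcard hgen
      ⟨1, one_mem_unityRoots⟩ (c := 1)
      (by rw [erase_eq_of_notMem fun h => ne_zero_of_mem_unityRoots hm0 h rfl, hH, one_mul]) 1
      (by omega)
    rwa [unityRootSums_one] at h1
  -- Otherwise H + H has exactly two orbits, H and xH, so (1 + h)^m takes only the values 1 and x^m.
  have hEq : S2.erase 0 = (A + A).erase 0 :=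
    eq_of_subset_of_card_le (erase_subset_erase 0 hS2A) (hAA.trans hS2card)
  have h0S2 : (0 : F) ∉ S2 := by
    intro h
    obtain ⟨a, ha, b, hb, hab⟩ := mem_add.mp h
    have ha0 := ne_zero_of_mem_unityRoots hm0 ha
    refine hneg (mem_unityRoots.mpr ?_)
    have h1 : b = -1 * a := by linear_combination hab
    have h2 := mem_unityRoots.mp hb
    rw [h1, mul_pow, mem_unityRoots.mp ha, mul_one] at h2
    exact h2
  rw [erase_eq_of_notMem h0S2] at hEq hS2card
  have hHS2 : unityRoots F m ⊆ S2 := fun h hh => by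
    rw [hEq]
    refine mem_erase.mpr ⟨ne_zero_of_mem_unityRoots hm0 hh, ?_⟩
    have := add_mem_add (hHA hh) h0A
    rwa [add_zero] at this
  have hdiff : (S2 \ unityRoots F m).card = m := by
    rw [card_sdiff_of_subset hHS2, hH, hEq]
    rw [hEq] at hS2card
    omega
  obtain ⟨x, hx⟩ : (S2 \ unityRoots F m).Nonempty := card_pos.mp (by omega)
  obtain ⟨hxS, hxH⟩ := mem_sdiff.mp hx
  have hx0 : x ≠ 0 := fun h => h0S2 (h ▸ hxS)
  have hxorb : (unityRoots F m).image (· * x) = S2 \ unityRoots F m := by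
    refine eq_of_subset_of_card_le (fun y hy => ?_) ?_
    · obtain ⟨h, hh, rfl⟩ := mem_image.mp hy
      refine mem_sdiff.mpr ⟨hS2st h hh x hxS, fun hy => hxH ?_⟩
      rw [mem_unityRoots, mul_pow, mem_unityRoots.mp hh, one_mul] at hy
      exact mem_unityRoots.mpr hy
    · rw [card_image_of_injective _ (mul_left_injective₀ hx0), hH, hdiff]
  have hval : ∀ h ∈ unityRoots F m, (h + 1) ^ m = 1 ∨ (h + 1) ^ m = x ^ m := by
    intro h hh
    have h1 : h + 1 ∈ S2 := add_mem_add hh one_mem_unityRoots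
    by_cases h2 : h + 1 ∈ unityRoots F m
    · exact Or.inl (mem_unityRoots.mp h2)
    · right
      have h3 := mem_sdiff.mpr ⟨h1, h2⟩
      rw [← hxorb] at h3
      obtain ⟨y, hy, hyx⟩ := mem_image.mp h3
      rw [← hyx, mul_pow, mem_unityRoots.mp hy, one_mul]
  have hmF : (m : F) ≠ 0 := by
    intro h
    have h1 : ((Fintype.card F : ℕ) : F) = 0 := FiniteField.cast_card_eq_zero F
    rw [hcard] at h1
    push_cast at h1
    rw [h, zero_mul, zero_add] at h1
    exact one_ne_zero h1
  have h2F : (2 : F) ≠ 0 := by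
    intro h
    refine hneg ?_
    rw [show (-1 : F) = 1 by linear_combination -h]
    exact one_mem_unityRoots
  have hu := eq_neg_one_of_add_one_pow hm hH hmF h2F (pow_ne_zero m hx0) hval
  have hodd : Odd m := by
    by_contra h
    exact hneg (mem_unityRoots.mpr (Nat.not_odd_iff_even.mp h).neg_one_pow)
  -- Thus zero is x + (-x) with x in H + H, a sum of three roots; H ⊆ H + H lengthens it to any
  -- number of terms.
  have hnx : -x ∈ unityRoots F m := mem_unityRoots.mpr (by rw [hodd.neg_pow, hu, neg_neg])
  have h3 : (0 : F) ∈ unityRootSums F m 3 := by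
    have := add_mem_add hxS hnx
    rw [add_neg_cancel] at this
    change (0 : F) ∈ unityRootSums F m 1 + unityRoots F m + unityRoots F m
    rwa [unityRootSums_one]
  have hmem : ∀ s, 3 ≤ s → (0 : F) ∈ unityRootSums F m s := by
    intro s hs
    induction s, hs using Nat.le_induction with
    | base => exact h3
    | succ s hs ih =>
      obtain ⟨r, rfl⟩ : ∃ r, s = r + 1 := ⟨s - 1, by omega⟩
      have h4 := add_subset_add_left (s := unityRootSums F m r) hHS2 ih
      rwa [hS2, ← add_assoc] at h4
  have hd0 := hmem d (by omega)
  rw [show d = 2 + (d - 2) by omega, unityRootSums_add] at hd0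
  refine add_subset_add_right ?_ hd0
  change unityRootSums F m 1 + unityRoots F m ⊆ _
  rwa [unityRootSums_one]

theorem unityRootSums_subset_add_add {n : ℕ} (hn : 1 ≤ n) :
    unityRootSums F m (2 * n) ⊆ insert 0 (unityRoots F m) + insert 0 (unityRoots F m) +
      unityRootSums F m (2 * (n - 1)) := by
  rw [show 2 * n = 2 + 2 * (n - 1) by omega, unityRootSums_add]
  refine add_subset_add_right ?_
  change unityRootSums F m 1 + unityRoots F m ⊆ _
  rw [unityRootSums_one]
  exact add_subset_add (subset_insert _ _) (subset_insert _ _)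

/-- Every element is a sum of `2n` terms which are roots of unity, up to two of them replaced by
zero. -/
theorem add_add_unityRootSums_eq_univ {d n : ℕ} (hm : 3 ≤ m) (hH : (unityRoots F m).card = m)
    (hcard : Fintype.card F = m * d + 1)
    (hgen : ∀ V : AddSubmonoid F, (∀ h ∈ unityRoots F m, h ∈ V) → V = ⊤)
    (hn : 2 ≤ n) (hd : d ≤ 2 * n) :
    insert 0 (unityRoots F m) + insert 0 (unityRoots F m) +
      unityRootSums F m (2 * (n - 1)) = univ := by
  have hsub := unityRootSums_subset_add_add (F := F) (m := m) (by omega : 1 ≤ n)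
  refine eq_univ_of_forall fun x => ?_
  by_cases hd' : d + 1 ≤ 2 * n
  · exact hsub (unityRootSums_eq_univ hm hH hcard hgen hd' ▸ mem_univ x)
  obtain rfl : d = 2 * n := by omega
  by_cases hx : x = 0
  swap
  · exact hsub (mem_unityRootSums_of_ne_zero hm hH hcard hgen hx)
  subst hx
  by_cases hneg : (-1 : F) ∈ unityRoots F m
  · refine hsub ?_
    have h2 : (0 : F) ∈ unityRootSums F m 2 := by
      change (0 : F) ∈ unityRootSums F m 1 + unityRoots F m
      rw [unityRootSums_one]
      have := add_mem_add hneg (one_mem_unityRoots (m := m))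
      rwa [neg_add_cancel] at this
    clear hsub hcard hn hd hd'
    induction n with
    | zero => exact mem_singleton_self 0
    | succ n ih =>
      rw [mul_add, mul_one, unityRootSums_add]
      have := add_mem_add ih h2
      rwa [add_zero] at this
  · rw [show 2 * (n - 1) = 2 * n - 2 by omega]
    exact zero_mem_add_add_unityRootSums hm hH hcard hgen (by omega) hneg

end ZeroSum

/-! ### From roots of unity to k-th powers and traces. -/

section PowerSums

open Finset
open scoped Pointwise

variable {F : Type*} [Field F] [Fintype F] [DecidableEq F] {m : ℕ}

theorem pow_mem_unityRoots {k d : ℕ} (hcard : Fintype.card F = m * d + 1) (hdk : d ∣ k) {x : F}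
    (hx : x ≠ 0) : x ^ k ∈ unityRoots F m := by
  obtain ⟨c, rfl⟩ := hdk
  have h := FiniteField.pow_card_sub_one_eq_one x hx
  rw [hcard, Nat.add_sub_cancel] at h
  rw [mem_unityRoots, ← pow_mul, show d * c * m = m * d * c by ring, pow_mul, h, one_pow]

/-- The k-th power map on the cyclic group of units has image of order (q-1)/d = m, contained in the
at most m roots of unity. -/
theorem card_unityRoots_and_exists_pow_eq {k d : ℕ} (hcard : Fintype.card F = m * d + 1)
    (hd : d = Nat.gcd k (Fintype.card F - 1)) :
    (unityRoots F m).card = m ∧ ∀ h ∈ unityRoots F m, ∃ x : F, x ^ k = h := by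
  have h1 := Fintype.one_lt_card (α := F)
  have hm : m ≠ 0 := by rintro rfl; omega
  have hd0 : 0 < d := by
    rcases Nat.eq_zero_or_pos d with h | h
    · rw [h] at hcard; omega
    · exact h
  have hu : Nat.card Fˣ = m * d := by
    rw [Nat.card_units, Nat.card_eq_fintype_card, hcard, Nat.add_sub_cancel]
  have h2 := IsCyclic.card_powMonoidHom_range (G := Fˣ) k
  have h3 : (Nat.card Fˣ).gcd k = d := by
    rw [hu, Nat.gcd_comm, show m * d = Fintype.card F - 1 by omega]
    exact hd.symm
  rw [h3, hu, Nat.mul_div_cancel _ hd0] at h2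
  let R : Finset F := (univ : Finset (powMonoidHom k : Fˣ →* Fˣ).range).image
    fun u => (u.1 : F)
  have hR : R.card = m := by
    rw [card_image_of_injective _ fun u v h => Subtype.ext (Units.ext h), card_univ,
      ← Nat.card_eq_fintype_card, h2]
  have hsub : R ⊆ unityRoots F m := fun y hy => by
    obtain ⟨⟨_, u, rfl⟩, -, rfl⟩ := mem_image.mp hy
    exact pow_mem_unityRoots hcard (hd ▸ Nat.gcd_dvd_left _ _) u.ne_zero
  have heq : R = unityRoots F m := eq_of_subset_of_card_le hsub (by
    rw [hR]; exact card_unityRoots_le hm)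
  refine ⟨heq ▸ hR, fun h hh => ?_⟩
  rw [← heq] at hh
  obtain ⟨⟨_, u, rfl⟩, -, rfl⟩ := mem_image.mp hh
  exact ⟨u, rfl⟩

theorem addSubmonoid_eq_top_of_sumset {k d : ℕ} (hcard : Fintype.card F = m * d + 1) (hdk : d ∣ k)
    (hk : k ≠ 0) (hgen : (⋃ s ≥ 1, sumset s (kPowers k F)) = Set.univ) (V : AddSubmonoid F)
    (hV : ∀ h ∈ unityRoots F m, h ∈ V) : V = ⊤ := by
  refine (AddSubmonoid.eq_top_iff' V).mpr fun x => ?_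
  have hx : x ∈ ⋃ s ≥ 1, sumset s (kPowers k F) := hgen ▸ Set.mem_univ x
  obtain ⟨s, -, f, hf, rfl⟩ := Set.mem_iUnion₂.mp hx
  refine sum_mem fun i _ => ?_
  obtain ⟨a, ha⟩ := hf i
  rw [← ha]
  by_cases ha0 : a = 0
  · rw [ha0, zero_pow hk]
    exact zero_mem V
  · exact hV _ (pow_mem_unityRoots hcard hdk ha0)

theorem exists_fin_of_mem_unityRootSums {s : ℕ} {y : F} (hy : y ∈ unityRootSums F m s) :
    ∃ f : Fin s → F, (∀ i, f i ∈ unityRoots F m) ∧ ∑ i, f i = y := by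
  induction s generalizing y with
  | zero => exact ⟨Fin.elim0, fun i => i.elim0, by rw [mem_singleton.mp hy]; rfl⟩
  | succ s ih =>
    obtain ⟨z, hz, h, hh, rfl⟩ := mem_add.mp hy
    obtain ⟨f, hf, rfl⟩ := ih hz
    refine ⟨Fin.cons h f, fun i => ?_, by rw [Fin.sum_univ_succ]; simp [add_comm]⟩
    refine Fin.cases hh hf i

theorem exists_fin_of_mem_insert_zero_add {k s : ℕ} (hm : m ≠ 0) (hk : k ≠ 0)
    (hpow : ∀ h ∈ unityRoots F m, ∃ x : F, x ^ k = h) {y : F}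
    (hy : y ∈ insert 0 (unityRoots F m) + unityRootSums F m s) :
    ∃ f : Fin (s + 1) → F, (∀ i, ∃ x, x ^ k = f i) ∧ (∀ i j, f i = 0 → f j = 0 → i = j) ∧
      ∑ i, f i = y := by
  obtain ⟨a, ha, z, hz, rfl⟩ := mem_add.mp hy
  obtain ⟨f, hf, rfl⟩ := exists_fin_of_mem_unityRootSums hz
  refine ⟨Fin.cons a f, fun i => ?_, ?_, by rw [Fin.sum_univ_succ]; simp⟩
  · refine Fin.cases ?_ (fun i => hpow _ (hf i)) i
    rcases mem_insert.mp ha with rfl | ha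
    · exact ⟨0, zero_pow hk⟩
    · exact hpow a ha
  · have h0 : ∀ i : Fin (s + 1), (Fin.cons a f : Fin (s + 1) → F) i = 0 → i = 0 := fun i =>
      Fin.cases (fun _ => rfl) (fun i hi => absurd hi (ne_zero_of_mem_unityRoots hm (hf i))) i
    exact fun i j hi hj => (h0 i hi).trans (h0 j hj).symm

theorem twoPowerSums_eq_univ_of_sums {k n : ℕ} (hm : m ≠ 0) (hk : (k : F) ≠ 0) (hn : 1 ≤ n)
    (hpow : ∀ h ∈ unityRoots F m, ∃ x : F, x ^ k = h)
    (hscalar : ∀ c : F, ∃ A B : Matrix (Fin n) (Fin n) F, A ^ k + B ^ k = Matrix.scalar (Fin n) c)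
    (hsum : insert 0 (unityRoots F m) + insert 0 (unityRoots F m) +
      unityRootSums F m (2 * (n - 1)) = univ) : twoPowerSums k n F = Set.univ := by
  refine Set.eq_univ_of_forall fun M => ?_
  suffices h : ∃ A B : Matrix (Fin n) (Fin n) F, A ^ k + B ^ k = M by
    obtain ⟨A, B, rfl⟩ := h
    refine ⟨![A ^ k, B ^ k], fun i => ?_, by simp⟩
    fin_cases i
    · exact ⟨A, rfl⟩
    · exact ⟨B, rfl⟩
  by_cases hM : ∃ c, M = Matrix.scalar (Fin n) c
  · obtain ⟨c, rfl⟩ := hM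
    exact hscalar c
  push Not at hM
  have hk0 : k ≠ 0 := by rintro rfl; simp at hk
  obtain ⟨r, rfl⟩ : ∃ r, n = r + 1 := ⟨n - 1, by omega⟩
  -- Regroup into two halves, each with one possibly zero term and n - 1 roots, one half per
  -- triangular matrix.
  rw [Nat.add_sub_cancel, two_mul, unityRootSums_add, add_add_add_comm] at hsum
  obtain ⟨y, hy, z, hz, hyz⟩ := mem_add.mp (hsum ▸ mem_univ M.trace)
  obtain ⟨a, ha, ha0, rfl⟩ := exists_fin_of_mem_insert_zero_add hm hk0 hpow hy
  obtain ⟨b, hb, hb0, rfl⟩ := exists_fin_of_mem_insert_zero_add hm hk0 hpow hz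
  exact exists_pow_add_pow_eq_of_trace hk hM ha hb ha0 hb0 hyz

end PowerSums

/-! ### The case d = 2 for scalars, and the conclusion. -/

theorem exists_scalar_of_gcd_eq_two {F : Type*} [Field F] [Fintype F] {k n : ℕ} (hk : k ≠ 0)
    (hd : Nat.gcd k (Nat.card F - 1) = 2) (c : F) :
    ∃ A B : Matrix (Fin n) (Fin n) F, A ^ k + B ^ k = Matrix.scalar (Fin n) c := by
  have hodd : Fintype.card F % 2 = 1 := by
    have h1 := Nat.gcd_dvd_right k (Nat.card F - 1)
    rw [hd, Nat.card_eq_fintype_card] at h1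
    have := Fintype.one_lt_card (α := F)
    omega
  obtain ⟨a, b, hab⟩ := FiniteField.exists_root_sum_quadratic (R := F) (f := Polynomial.X ^ 2)
    (g := Polynomial.X ^ 2 - Polynomial.C c) (Polynomial.degree_X_pow 2)
    (Polynomial.degree_X_pow_sub_C two_pos c) hodd
  simp only [Polynomial.eval_pow, Polynomial.eval_X, Polynomial.eval_sub, Polynomial.eval_C] at hab
  obtain ⟨a', ha⟩ := exists_pow_eq_pow_gcd k hk a
  obtain ⟨b', hb⟩ := exists_pow_eq_pow_gcd k hk b
  rw [hd] at ha hb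
  refine ⟨Matrix.scalar (Fin n) a', Matrix.scalar (Fin n) b', ?_⟩
  rw [← map_pow, ← map_pow, ← map_add, ha, hb]
  congr 1
  linear_combination hab

theorem pow_four_lt_pow_of_log_lt {k q n : ℕ} (hk : 2 < k) (hq : 1 < q)
    (h : 4 * Real.log ((k : ℝ) - 1) / Real.log (q : ℝ) < (n : ℝ)) : (k - 1) ^ 4 < q ^ n := by
  have hlog : 0 < Real.log (q : ℝ) := Real.log_pos (by exact_mod_cast hq)
  rw [div_lt_iff₀ hlog] at h
  have hk1 : ((k - 1 : ℕ) : ℝ) = (k : ℝ) - 1 := by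
    rw [Nat.cast_sub (by omega), Nat.cast_one]
  have hpos : (0 : ℝ) < ((k - 1 : ℕ) : ℝ) := by
    exact_mod_cast (by omega : 0 < k - 1)
  rw [← hk1] at h
  have h2 : Real.log (((k - 1 : ℕ) : ℝ) ^ 4) < Real.log ((q : ℝ) ^ n) := by
    rw [Real.log_pow, Real.log_pow]
    exact_mod_cast h
  have h3 := (Real.log_lt_log_iff (pow_pos hpos 4)
    (pow_pos (by exact_mod_cast (by omega : 0 < q)) n)).mp h2
  exact_mod_cast h3

theorem theorem1p16 (p l q k n d ℓ : ℕ) (hp : p.Prime) (hl : 1 ≤ l) (hq : q = p ^ l)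
    (hk : 1 ≤ k) (hn : 2 ≤ n)
    (F : Type*) [Field F] [Finite F] (hF : Nat.card F = q)
    (hd : d = Nat.gcd k (q - 1))
    (hℓ : IsPowerSumExponent p k F ℓ) (hℓl : ℓ = l) (hpk : ¬ p ∣ k) :
    (3 * d + 1 ≤ q →
      (d = 2 ∨ (2 < d ∧
        max (((d : ℝ) - 1) / 2) (4 * Real.log ((k : ℝ) - 1) / Real.log (q : ℝ)) < (n : ℝ))) →
      twoPowerSums k n F = Set.univ) ∧
    (q = 2 * d + 1 →
      (d = 2 ∨ (2 < d ∧
        max (2 * (d : ℝ) - 1) (4 * Real.log ((k : ℝ) - 1) / Real.log (q : ℝ)) < (n : ℝ))) →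
      twoPowerSums k n F = Set.univ) := by
  classical
  have := Fintype.ofFinite F
  have hcF : Fintype.card F = q := by rw [← Nat.card_eq_fintype_card, hF]
  have hq1 : 1 < q := hcF ▸ Fintype.one_lt_card
  have hk0 : k ≠ 0 := by omega
  have hdk : d ∣ k := hd ▸ Nat.gcd_dvd_left _ _
  have hdle : d ≤ k := Nat.le_of_dvd hk hdk
  have : Fact p.Prime := ⟨hp⟩
  have : CharP F p := charP_of_card_eq_prime_pow (hcF.trans hq)
  have hkF : (k : F) ≠ 0 := fun h => hpk ((CharP.cast_eq_zero_iff F p k).mp h)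
  obtain ⟨m, hm⟩ : ∃ m, q - 1 = d * m := hd ▸ Nat.gcd_dvd_right k (q - 1)
  have hcard : Fintype.card F = m * d + 1 := by rw [hcF, mul_comm]; omega
  have hgen : (⋃ s ≥ 1, sumset s (kPowers k F)) = Set.univ := by
    obtain ⟨K, hK, hKe⟩ := hℓ
    rw [hKe]
    refine Set.eq_univ_of_forall fun x => ?_
    by_contra hx
    have h0 : (K : Set F) ≠ Set.univ := fun h => hx (h ▸ Set.mem_univ x : x ∈ (K : Set F))
    have h1 := Set.ncard_lt_ncard (Set.ssubset_univ_iff.mpr h0) Set.finite_univ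
    rw [Set.ncard_univ, hF, hq, ← hℓl, ← hK] at h1
    exact lt_irrefl _ h1
  have hgen' := addSubmonoid_eq_top_of_sumset hcard hdk hk0 hgen
  obtain ⟨hH, hpow⟩ := card_unityRoots_and_exists_pow_eq hcard (by rw [hcF]; exact hd)
  have hscalar2 : d = 2 → ∀ c : F, ∃ A B : Matrix (Fin n) (Fin n) F,
      A ^ k + B ^ k = Matrix.scalar (Fin n) c := fun h2 c =>
    exists_scalar_of_gcd_eq_two hk0 (by rw [hF, ← hd, h2]) c
  have hscalar : 2 < d → 4 * Real.log ((k : ℝ) - 1) / Real.log (q : ℝ) < (n : ℝ) →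
      ∀ c : F, ∃ A B : Matrix (Fin n) (Fin n) F, A ^ k + B ^ k = Matrix.scalar (Fin n) c :=
    fun h2 h c => exists_matrix_pow_add_pow_eq_scalar hk0 (by omega)
      (by rw [hF]; exact pow_four_lt_pow_of_log_lt (by omega) hq1 h) c
  constructor
  · intro hqd h
    have hd0 : 0 < d := by omega
    have hm3 : 3 ≤ m := by
      refine le_of_mul_le_mul_left (a := d) ?_ hd0
      omega
    have hdn : d ≤ 2 * n := by
      rcases h with h | ⟨-, h⟩
      · omega
      · have h1 := (le_max_left _ _).trans_lt h
        have h2 : (d : ℝ) < 2 * n + 1 := by linarith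
        have h3 : d < 2 * n + 1 := by exact_mod_cast h2
        omega
    refine twoPowerSums_eq_univ_of_sums (by omega) hkF (by omega) hpow ?_
      (add_add_unityRootSums_eq_univ hm3 hH hcard hgen' hn hdn)
    rcases h with h | ⟨h2, h⟩
    · exact hscalar2 h
    · exact hscalar h2 ((le_max_right _ _).trans_lt h)
  · intro hqd h
    have hd0 : 0 < d := by omega
    have hm2 : m = 2 := by
      refine Nat.eq_of_mul_eq_mul_left hd0 ?_
      omega
    -- Here m = 2, and 2n summands growing by one element each must fill F; this amounts to d ≤ n.
    have hdn : q ≤ 2 * n + 1 := by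
      rcases h with h | ⟨-, h⟩
      · omega
      · have h1 := (le_max_left _ _).trans_lt h
        have h2 : (2 * d : ℝ) < n + 1 := by linarith
        have h3 : 2 * d < n + 1 := by exact_mod_cast h2
        omega
    refine twoPowerSums_eq_univ_of_sums (by omega) hkF (by omega) hpow ?_ ?_
    · rcases h with h | ⟨h2, h⟩
      · exact hscalar2 h
      · exact hscalar h2 ((le_max_right _ _).trans_lt h)
    · refine Finset.univ_subset_iff.mp ?_
      rw [← unityRootSums_eq_univ_of_card_le (by rw [hH, hm2]) hgen' (hcF.trans_le hdn)]
      exact unityRootSums_subset_add_add (by omega)
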